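/- A group $G$ is LEF if for every finite subset $A\subseteq G$ there are a finite group $Q$ and an injective map $\phi:A\to Q$ with $\phi(gh)=\phi(g)\phi(h)$ whenever $g,h,gh\in A$. An action $\alpha$ of a group $\Gamma$ on a graph $X=(V,E)$ (simple, undirected) by graph automorphisms is a LEF action if for every finite $F\subseteq\Gamma$ and every finite induced subgraph $Z$ of $X$ there are a finite group $Q$, a finite graph $Y$, an action $\beta$ of $Q$ on $Y$ by graph automorphisms, a function $\rho:\Gamma\to Q$ and an embedding $\pi:Z\hookrightarrow Y$ as an induced subgraph, such that $\rho(gh)=\rho(g)\rho(h)$ whenever $g,h,gh\in F$, and $\pi(\alpha(g)\cdot x)=\beta(\rho(g))\cdot\pi(x)$ whenever $g\in F$ and $x$, $\alpha(g)\cdot x$ are vertices of $Z$. For a group $H$ and a graph $X=(V,E)$, let $$P(H,X)=\Big(\ast_{v\in V}H_v\Big)\Big/\big\langle\!\big\langle h^{-1}k^{-1}hk : (v,w)\in E,\ h\in H_v,\ k\in H_w\big\rangle\!\big\rangle$$ where each $H_v$ is a copy of $H$. An action $\alpha$ of $\Gamma$ on $X$ by graph automorphisms induces an action $\hat\alpha$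 of $\Gamma$ on $P(H,X)$ by automorphisms, $\hat\alpha(g)$ sending the copy $H_v$ identically onto $H_{\alpha(g)\cdot v}$; the graph wreath product is $\mathcal{W}(\Gamma,H,X)=P(H,X)\rtimes_{\hat\alpha}\Gamma$. **Theorem.** Let $\Gamma$ and $H$ be groups with $H$ nontrivial, and let $\Gamma$ act by graph automorphisms, via $\alpha$, on a graph $X$ with nonempty vertex set. Then $\mathcal{W}(\Gamma,H,X)$ is LEF if and only if $\Gamma$ and $H$ are LEF and $\alpha$ is a LEF action on the graph $X$. -/

import Mathlib

universe u v w

/-! ### LEF groups -/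

/-- `φ` is a partial homomorphism on the set `A`: only its values on `A` matter. -/
def IsPartialHomOn {G D : Type*} [Group G] [Group D] (A : Finset G) (φ : G → D) : Prop :=
  ∀ g ∈ A, ∀ h ∈ A, g * h ∈ A → φ (g * h) = φ g * φ h

/-- A group is LEF if every finite subset admits an injective partial homomorphism
to some finite group. (Every finite group has a copy in `Type`.) -/
def IsLEF (G : Type*) [Group G] : Prop :=
  ∀ A : Finset G, ∃ (Q : Type) (_ : Group Q) (_ : Finite Q) (φ : G → Q),
    IsPartialHomOn A φ ∧ Set.InjOn φ (A : Set G)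

/-! ### LEF actions on graphs -/

/-- An action `α` of `Γ` on the graph `X` by graph automorphisms is LEF if for all finite
`F ⊆ Γ` and all finite induced subgraphs (on a vertex set `Z`), there are a finite group `Q`
acting on a finite graph `Y` by graph automorphisms, a map `ρ : Γ → Q` that is a partial
homomorphism on `F`, and an embedding `π` of the subgraph induced on `Z` as an induced subgraph
of `Y`, which is equivariant wherever this makes sense. -/
def IsLEFGraphAction {Γ V : Type*} [Group Γ] {X : SimpleGraph V} (α : Γ →* (X ≃g X)) : Prop :=
  ∀ (F : Finset Γ) (Z : Finset V),
    ∃ (Q : Type) (_ : Group Q) (_ : Finite Q) (W : Type) (_ : Finite W) (Y : SimpleGraph W)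
      (β : Q →* (Y ≃g Y)) (ρ : Γ → Q) (π : X.induce (Z : Set V) ↪g Y),
      IsPartialHomOn F ρ ∧
      ∀ g ∈ F, ∀ (x : V) (hx : x ∈ Z) (hgx : α g x ∈ Z),
        π ⟨α g x, hgx⟩ = β (ρ g) (π ⟨x, hx⟩)

/-! ### Graph products -/

/-- The commutators `h⁻¹ k⁻¹ h k` in the free product of the `H v`, for `h ∈ H v`, `k ∈ H w`,
with `v` and `w` adjacent. -/
def graphProductRels {V : Type*} (H : V → Type*) [∀ v, Group (H v)] (X : SimpleGraph V) :
    Set (Monoid.CoprodI H) :=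
  {x | ∃ v w, X.Adj v w ∧ ∃ (h : H v) (k : H w),
    x = (Monoid.CoprodI.of h)⁻¹ * (Monoid.CoprodI.of k)⁻¹ *
      Monoid.CoprodI.of h * Monoid.CoprodI.of k}

/-- The graph product of the family `H` of groups over the graph `X`. -/
abbrev GraphProduct {V : Type*} (H : V → Type*) [∀ v, Group (H v)] (X : SimpleGraph V) : Type _ :=
  Monoid.CoprodI H ⧸ Subgroup.normalClosure (graphProductRels H X)

namespace GraphProduct

/-- The canonical map of a vertex group to the graph product. -/
def of {V : Type*} {H : V → Type*} [∀ v, Group (H v)] (X : SimpleGraph V) (v : V) :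
    H v →* GraphProduct H X :=
  (QuotientGroup.mk' _).comp Monoid.CoprodI.of

theorem of_commute {V : Type*} {H : V → Type*} [∀ v, Group (H v)] {X : SimpleGraph V} {v w : V}
    (hvw : X.Adj v w) (h : H v) (k : H w) : of X v h * of X w k = of X w k * of X v h := by
  have key : (of X v h)⁻¹ * (of X w k)⁻¹ * of X v h * of X w k = 1 :=
    (QuotientGroup.eq_one_iff _).2 (Subgroup.subset_normalClosure ⟨v, w, hvw, h, k, rfl⟩)
  have h2 : of X v h * of X w k =
      of X w k * of X v h * ((of X v h)⁻¹ * (of X w k)⁻¹ * of X v h * of X w k) := by group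
  rw [h2, key, mul_one]

theorem hom_ext {V : Type*} {H : V → Type*} [∀ v, Group (H v)] {X : SimpleGraph V}
    {M : Type*} [Monoid M] {f g : GraphProduct H X →* M}
    (hfg : ∀ v (h : H v), f (of X v h) = g (of X v h)) : f = g := by
  apply QuotientGroup.monoidHom_ext
  apply Monoid.CoprodI.ext_hom
  intro v
  ext h
  exact hfg v h

/-- The map of graph products of copies of a fixed group `H` that is induced by a map of graphs:
the copy of `H` at `v` is sent identically to the copy of `H` at `f v`. -/
def map (H : Type*) [Group H] {V V' : Type*} {X : SimpleGraph V} {Y : SimpleGraph V'}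
    (f : X →g Y) : GraphProduct (fun _ : V => H) X →* GraphProduct (fun _ : V' => H) Y :=
  QuotientGroup.lift _ (Monoid.CoprodI.lift fun v => of (H := fun _ : V' => H) Y (f v)) (by
    apply Subgroup.normalClosure_le_normal
    rintro _ ⟨v, w, hvw, h, k, rfl⟩
    simp only [SetLike.mem_coe, MonoidHom.mem_ker, map_mul, map_inv, Monoid.CoprodI.lift_of]
    rw [mul_assoc, of_commute (H := fun _ : V' => H) (f.map_adj hvw) h k]
    group)

@[simp]
theorem map_of (H : Type*) [Group H] {V V' : Type*} {X : SimpleGraph V} {Y : SimpleGraph V'}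
    (f : X →g Y) (v : V) (h : H) :
    map H f (of (H := fun _ : V => H) X v h) = of (H := fun _ : V' => H) Y (f v) h := by
  change (Monoid.CoprodI.lift fun v => of (H := fun _ : V' => H) Y (f v))
    (Monoid.CoprodI.of (M := fun _ : V => H) (i := v) h) = _
  rw [Monoid.CoprodI.lift_of]

/-- The action of the automorphism group of `X` on the graph product of copies of `H`,
by permuting the copies. -/
def autAction (H : Type*) [Group H] {V : Type*} (X : SimpleGraph V) :
    (X ≃g X) →* MulAut (GraphProduct (fun _ : V => H) X) where
  toFun f := MonoidHom.toMulEquiv (map H f.toHom) (map H f.symm.toHom)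
    (hom_ext fun v h => by simp) (hom_ext fun v h => by simp)
  map_one' := by
    ext x
    exact DFunLike.congr_fun (hom_ext (f := map H (1 : X ≃g X).toHom) (g := MonoidHom.id _)
      fun v h => by rw [map_of]; rfl) x
  map_mul' f g := by
    ext x
    exact DFunLike.congr_fun (hom_ext (f := map H (f * g).toHom)
      (g := (map H f.toHom).comp (map H g.toHom)) fun v h => by
        rw [MonoidHom.comp_apply, map_of, map_of, map_of]; rfl) x

theorem autAction_of (H : Type*) [Group H] {V : Type*} (X : SimpleGraph V) (f : X ≃g X)
    (v : V) (h : H) :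
    autAction H X f (of (H := fun _ : V => H) X v h) = of (H := fun _ : V => H) X (f v) h :=
  map_of H f.toHom v h

end GraphProduct

/-- The graph wreath product: the semidirect product of the graph product `P(H, X)` of copies of
`H` with `Γ`, with respect to the action of `Γ` that `α` induces by permuting the copies. -/
abbrev GraphWreathProduct {Γ : Type*} (H : Type*) [Group Γ] [Group H] {V : Type*}
    {X : SimpleGraph V} (α : Γ →* (X ≃g X)) : Type _ :=
  GraphProduct (fun _ : V => H) X ⋊[(GraphProduct.autAction H X).comp α] Γ

/-!
If the wreath product `W` is LEF, then so are its subgroups `Γ` and `H`. For `1 ≠ h : H`, the map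
that sends a vertex `v` to the copy of `h` at `v` embeds `X` in the commuting graph of `W`, and
turns `α` into conjugation by elements of `Γ`. Conjugation is a LEF action on the commuting graph,
since commutation is an equation between products of two elements and can be detected in finite
groups.

For the converse, local models of `α` by actions on finite graphs reduce the claim to graph products
of LEF groups over finite graphs. These are treated by induction on the number of vertices. Removing
a vertex `v` leaves a graph product `G` with a retraction `r` to the part supported on the
neighbours of `v`, and the whole graph product embeds in the wreath product of the group at `v` with
the edgeless graph on `G`, on which `g` acts by `x ↦ g x r(g)⁻¹`. This action has local models given
by two-sided multiplication in finite groups, which reduces the claim to edgeless graphs, that is,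
to free products. Local embeddings of the factors extend letter by letter to free products, and free
products of finite groups are residually finite: they act on the words of bounded length.
-/

open Monoid

theorem IsPartialHomOn.of_monoidHom {G D : Type*} [Group G] [Group D] (A : Finset G)
    (f : G →* D) : IsPartialHomOn A f :=
  fun g _ h _ _ => map_mul f g h

theorem IsPartialHomOn.map_one {G D : Type*} [Group G] [Group D] {A : Finset G} {φ : G → D}
    (hφ : IsPartialHomOn A φ) (h1 : 1 ∈ A) : φ 1 = 1 := by
  simpa using hφ 1 h1 1 h1 (by simpa using h1)

theorem IsPartialHomOn.comp {G D K : Type*} [Group G] [Group D] [Group K] {A : Finset G}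
    {B : Finset D} {ψ : D → K} {φ : G → D} (hψ : IsPartialHomOn B ψ) (hφ : IsPartialHomOn A φ)
    (hAB : ∀ a ∈ A, φ a ∈ B) : IsPartialHomOn A (ψ ∘ φ) := by
  intro g hg h hh hgh
  have hφgh := hφ g hg h hh hgh
  simp only [Function.comp_apply, hφgh]
  exact hψ _ (hAB g hg) _ (hAB h hh) (hφgh ▸ hAB _ hgh)

namespace IsLEF

theorem of_exists_isPartialHomOn {G : Type u} [Group G]
    (hG : ∀ A : Finset G, ∃ (K : Type v) (_ : Group K) (φ : G → K),
      IsLEF K ∧ IsPartialHomOn A φ ∧ Set.InjOn φ (A : Set G)) : IsLEF G := by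
  classical
  intro A
  obtain ⟨K, _, φ, hK, hφ, hφinj⟩ := hG A
  obtain ⟨Q, _, _, ψ, hψ, hψinj⟩ := hK (A.image φ)
  have hmem (g : G) (hg : g ∈ A) : φ g ∈ A.image φ := Finset.mem_image_of_mem φ hg
  exact ⟨Q, inferInstance, inferInstance, ψ ∘ φ, hψ.comp hφ hmem, hψinj.comp hφinj hmem⟩

theorem of_finite (G : Type*) [Group G] [Finite G] : IsLEF G := by
  obtain ⟨Q, _, _, ⟨e⟩⟩ := Finite.exists_type_univ_nonempty_mulEquiv.{_, 0} G
  exact fun A => ⟨Q, inferInstance, Finite.of_fintype Q, e,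
    IsPartialHomOn.of_monoidHom A e.toMonoidHom, e.injective.injOn⟩

theorem of_injective {G : Type u} {K : Type v} [Group G] [Group K] (hK : IsLEF K) (f : G →* K)
    (hf : Function.Injective f) : IsLEF G :=
  of_exists_isPartialHomOn fun A =>
    ⟨K, inferInstance, f, hK, IsPartialHomOn.of_monoidHom A f, hf.injOn⟩

theorem of_residuallyFinite (G : Type u) [Group G] [Group.ResiduallyFinite G] : IsLEF G := by
  classical
  refine of_exists_isPartialHomOn.{u, u} fun A => ?_
  have hsep (p : A.offDiag) :
      ∃ N : FiniteIndexNormalSubgroup G, (p.1.1 : G ⧸ N.toSubgroup) ≠ p.1.2 :=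
    Group.exists_finiteIndexNormalSubgroup_of_residuallyFinite _ _ (Finset.mem_offDiag.1 p.2).2.2
  choose N hN using hsep
  refine ⟨∀ p, G ⧸ (N p).toSubgroup, inferInstance,
    MonoidHom.pi fun p => QuotientGroup.mk' (N p).toSubgroup, of_finite _,
    IsPartialHomOn.of_monoidHom _ _, fun a ha b hb hab => ?_⟩
  by_contra hne
  let p : A.offDiag := ⟨(a, b), Finset.mem_offDiag.2 ⟨ha, hb, hne⟩⟩
  exact hN p (congrFun hab p)

theorem exists_mul_eq_mul_iff {G : Type*} [Group G] (hG : IsLEF G) (B : Finset G) :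
    ∃ (Q : Type) (_ : Group Q) (_ : Finite Q) (φ : G → Q),
      IsPartialHomOn B φ ∧ Set.InjOn φ (B : Set G) ∧
      ∀ a ∈ B, ∀ b ∈ B, ∀ c ∈ B, ∀ d ∈ B, φ a * φ b = φ c * φ d ↔ a * b = c * d := by
  classical
  open scoped Pointwise in
  obtain ⟨Q, _, _, φ, hφ, hinj⟩ := hG (B ∪ B * B)
  have hB : B ⊆ B ∪ B * B := Finset.subset_union_left
  have hBB {a b} (ha : a ∈ B) (hb : b ∈ B) : a * b ∈ B ∪ B * B :=
    Finset.mem_union_right _ (Finset.mul_mem_mul ha hb)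
  have hmul {a b} (ha : a ∈ B) (hb : b ∈ B) : φ (a * b) = φ a * φ b :=
    hφ a (hB ha) b (hB hb) (hBB ha hb)
  refine ⟨Q, inferInstance, inferInstance, φ, fun a ha b hb _ => hmul ha hb,
    hinj.mono (Finset.coe_subset.2 hB), fun a ha b hb c hc d hd => ?_⟩
  rw [← hmul ha hb, ← hmul hc hd]
  exact hinj.eq_iff (hBB ha hb) (hBB hc hd)

theorem semidirectProduct {N : Type u} {Q : Type v} [Group N] [Group Q] [Finite Q]
    (hN : IsLEF N) (θ : Q →* MulAut N) : IsLEF (N ⋊[θ] Q) := by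
  classical
  have := Fintype.ofFinite Q
  refine of_exists_isPartialHomOn.{max u v, v} fun A => ?_
  let B : Finset N := A.biUnion fun a => Finset.univ.image fun q => θ q a.left
  have hB {a : N ⋊[θ] Q} (ha : a ∈ A) (q : Q) : θ q a.left ∈ B :=
    Finset.mem_biUnion.2 ⟨a, ha, Finset.mem_image_of_mem _ (Finset.mem_univ q)⟩
  obtain ⟨K, _, _, φ, hφ, hinj⟩ := hN B
  -- The Kaloujnine–Krasner embedding in `N ≀ᵣ Q`, with `φ` applied to each coordinate.
  refine ⟨K ≀ᵣ Q, inferInstance, fun a => ⟨fun q => φ (θ q⁻¹ a.left), a.right⟩, of_finite _,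
    fun a ha b hb hab => ?_, fun a ha b hb hab => ?_⟩
  · refine RegularWreathProduct.ext (funext fun q => ?_) rfl
    have hmul : θ q⁻¹ (a * b).left = θ q⁻¹ a.left * θ (q⁻¹ * a.right) b.left := by
      simp only [SemidirectProduct.mul_left, map_mul, MulAut.mul_apply]
    have hinv : (a.right⁻¹ * q)⁻¹ = q⁻¹ * a.right := by group
    simp only [RegularWreathProduct.mul_left, Pi.mul_apply, hinv, hmul]
    exact hφ _ (hB ha _) _ (hB hb _) (hmul ▸ hB hab _)
  · obtain ⟨hleft, hright⟩ := RegularWreathProduct.ext_iff.1 hab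
    refine SemidirectProduct.ext (hinj ?_ ?_ ?_) hright
    · simpa using hB ha 1
    · simpa using hB hb 1
    · simpa using congrFun hleft 1

end IsLEF

/-! ### Free products -/

section FreeProduct

theorem injOn_list_map {α : Type u} {β : Type v} {f : α → β} {s : Set α} (hf : Set.InjOn f s) :
    Set.InjOn (List.map f) {l | ∀ a ∈ l, a ∈ s} := by
  intro l hl l' hl' h
  have hlength : l.length = l'.length := by simpa using congrArg List.length h
  refine List.ext_getElem hlength fun n hn hn' =>
    hf (hl _ (List.getElem_mem hn)) (hl' _ (List.getElem_mem hn')) ?_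
  have hget := List.getElem_of_eq h (i := n) (by simpa using hn)
  rwa [List.getElem_map, List.getElem_map] at hget

open Monoid.CoprodI

variable {ι : Type u} {M : ι → Type v} {N : ι → Type w} [∀ i, Group (M i)] [∀ i, Group (N i)]

/-- The words over the family `M` all of whose letters belong to the sets `T i`. -/
def HasLettersIn (T : ∀ i, Finset (M i)) (w : Word M) : Prop :=
  ∀ l ∈ w.toList, l.2 ∈ T l.1

/-- The element of the free product of the `N i` obtained from a word over the `M i` by applying
the maps `φ i` to its letters. The `φ i` need not be homomorphisms. -/
def mapLetters (φ : ∀ i, M i → N i) (w : Word M) : CoprodI N :=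
  (w.toList.map fun l => of (φ l.1 l.2)).prod

theorem mapLetters_injOn {φ : ∀ i, M i → N i} {T : ∀ i, Finset (M i)} (h1T : ∀ i, 1 ∈ T i)
    (hφ1 : ∀ i, φ i 1 = 1) (hφ : ∀ i, Set.InjOn (φ i) (T i)) :
    Set.InjOn (mapLetters φ) {w | HasLettersIn T w} := by
  classical
  let letterMap : (Σ i, M i) → Σ i, N i := Sigma.map id φ
  have hletter : Set.InjOn letterMap {l | l.2 ∈ T l.1} := by
    rintro ⟨i, x⟩ hx ⟨j, y⟩ hy hxy
    obtain ⟨rfl, hφxy⟩ := Sigma.mk.inj_iff.1 hxy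
    exact congrArg (Sigma.mk i) (hφ i hx hy (eq_of_heq hφxy))
  let mapWord (w : Word M) (hw : HasLettersIn T w) : Word N :=
    { toList := w.toList.map letterMap
      ne_one := by
        rw [List.forall_mem_map]
        exact fun l hl h => w.ne_one l hl (hφ l.1 (hw l hl) (h1T l.1) (h.trans (hφ1 l.1).symm))
      chain_ne := (List.isChain_map _).2 w.chain_ne }
  have hprod (w) (hw : HasLettersIn T w) : (mapWord w hw).prod = mapLetters φ w := by
    simp only [mapWord, Word.prod, mapLetters, List.map_map]
    rfl
  intro w hw w' hw' h
  rw [← hprod w hw, ← hprod w' hw'] at h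
  have hmap : w.toList.map letterMap = w'.toList.map letterMap :=
    congrArg Word.toList (Word.equiv.symm.injective h)
  exact Word.ext (injOn_list_map hletter hw hw' hmap)

theorem finite_word_length_le [Finite ι] [∀ i, Finite (M i)] (n : ℕ) :
    Finite {w : Word M // w.toList.length ≤ n} :=
  ((List.finite_length_le (Σ i, M i) n).preimage
    fun _ _ _ _ => Word.ext).to_subtype

theorem exists_hasLettersIn (W : Finset (Word M)) :
    ∃ T : ∀ i, Finset (M i), (∀ i, 1 ∈ T i) ∧ ∀ w ∈ W, HasLettersIn T w := by
  classical
  refine ⟨fun i => insert 1 ((W.biUnion fun w => w.toList.toFinset).preimage (Sigma.mk i)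
    sigma_mk_injective.injOn), fun i => Finset.mem_insert_self _ _, fun w hw l hl => ?_⟩
  exact Finset.mem_insert_of_mem (Finset.mem_preimage.2
    (Finset.mem_biUnion.2 ⟨w, hw, List.mem_toFinset.2 hl⟩))

section DecidableEq

variable [∀ i, DecidableEq (M i)]

theorem mapLetters_rcons {φ : ∀ i, M i → N i} {i : ι} (hφ1 : φ i 1 = 1) (p : Word.Pair M i) :
    mapLetters φ (Word.rcons p) = of (φ i p.head) * mapLetters φ p.tail := by
  unfold Word.rcons
  split_ifs with h
  · rw [h, hφ1, map_one, one_mul]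
  · simp only [mapLetters, Word.cons, List.map_cons, List.prod_cons]

theorem length_rcons_le {i : ι} (p : Word.Pair M i) :
    (Word.rcons p).toList.length ≤ p.tail.toList.length + 1 := by
  unfold Word.rcons
  split_ifs
  · exact Nat.le_succ _
  · rfl

variable [DecidableEq ι]

theorem HasLettersIn.head_mem {T : ∀ i, Finset (M i)} {w : Word M} (hw : HasLettersIn T w)
    {i : ι} (h1 : 1 ∈ T i) : (Word.equivPair i w).head ∈ T i := by
  by_cases h : (Word.equivPair i w).head = 1
  · rwa [h]
  · have hmem := (Word.mem_rcons_iff (Word.equivPair i w) _).2 (Or.inr ⟨h, rfl, rfl⟩)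
    rw [← Word.equivPair_symm, Equiv.symm_apply_apply] at hmem
    exact hw _ hmem

theorem mapLetters_of_smul {φ : ∀ i, M i → N i} {T : ∀ i, Finset (M i)} {i : ι} {m : M i}
    {w : Word M} (h1 : 1 ∈ T i) (hφ : IsPartialHomOn (T i) (φ i)) (hm : m ∈ T i)
    (hw : HasLettersIn T w) (hmw : HasLettersIn T (of m • w)) :
    mapLetters φ (of m • w) = of (φ i m) * mapLetters φ w := by
  have hφ1 : φ i 1 = 1 := hφ.map_one h1
  have hmul : m * (Word.equivPair i w).head ∈ T i := by
    simpa only [Word.equivPair_smul_same] using hmw.head_mem h1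
  calc mapLetters φ (of m • w)
      = of (φ i (m * (Word.equivPair i w).head)) * mapLetters φ (Word.equivPair i w).tail := by
        rw [Word.of_smul_def, mapLetters_rcons hφ1]
    _ = of (φ i m) * mapLetters φ (Word.rcons (Word.equivPair i w)) := by
        rw [hφ m hm _ (hw.head_mem h1) hmul, map_mul, mul_assoc, mapLetters_rcons hφ1]
    _ = of (φ i m) * mapLetters φ w := by
        rw [← Word.equivPair_symm, Equiv.symm_apply_apply]

theorem mapLetters_prod_smul {φ : ∀ i, M i → N i} {T : ∀ i, Finset (M i)} (h1 : ∀ i, 1 ∈ T i)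
    (hφ : ∀ i, IsPartialHomOn (T i) (φ i)) {w : Word M} {L : List (Σ i, M i)}
    (hL : ∀ l ∈ L, l.2 ∈ T l.1)
    (hLw : ∀ L', L' <:+ L → HasLettersIn T ((L'.map fun l => of l.2).prod • w)) :
    mapLetters φ ((L.map fun l => of l.2).prod • w) =
      (L.map fun l => of (φ l.1 l.2)).prod * mapLetters φ w := by
  induction L with
  | nil => simp only [List.map_nil, List.prod_nil, one_smul, one_mul]
  | cons l L ih =>
    have hcons := hLw (l :: L) List.suffix_rfl
    simp only [List.map_cons, List.prod_cons, mul_smul] at hcons ⊢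
    rw [mapLetters_of_smul (h1 _) (hφ _) (hL l List.mem_cons_self)
      (hLw L (List.suffix_cons l L)) hcons, mul_assoc,
      ih (fun l hl => hL l (List.mem_cons_of_mem _ hl))
        fun L' hL' => hLw L' (hL'.trans (List.suffix_cons _ _))]

/-- The words with fewer than `n` letters after a possible first letter in `M i`. Their orbits under
`M i` consist of words of length at most `n`. -/
def shortOrbitWords (M : ι → Type v) [∀ i, Group (M i)] [∀ i, DecidableEq (M i)] (n : ℕ) (i : ι) :
    SubMulAction (M i) (Word M) where
  carrier := {w | (Word.equivPair i w).tail.toList.length < n}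
  smul_mem' m w hw := by
    simpa only [Set.mem_ofPred_eq, Word.smul_eq_of_smul, Word.equivPair_smul_same] using hw

theorem length_le_of_mem_shortOrbitWords {n : ℕ} {i : ι} {w : Word M}
    (hw : w ∈ shortOrbitWords M n i) : w.toList.length ≤ n := by
  rw [← (Word.equivPair i).symm_apply_apply w, Word.equivPair_symm]
  exact (length_rcons_le _).trans (Nat.succ_le_of_lt hw)

/-- The action of `M i` on the words of length at most `n` that multiplies the words in
`shortOrbitWords M n i` on the left, and fixes the other words. -/
noncomputable def truncatedPerm (M : ι → Type v) [∀ i, Group (M i)] [∀ i, DecidableEq (M i)]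
    (n : ℕ) (i : ι) : M i →* Equiv.Perm {w : Word M // w.toList.length ≤ n} :=
  (Equiv.Perm.viaEmbeddingHom (Subtype.impEmbedding (· ∈ shortOrbitWords M n i) _
    fun _ => length_le_of_mem_shortOrbitWords)).comp
      (MulAction.toPermHom (M i) (shortOrbitWords M n i))

theorem truncatedPerm_apply {n : ℕ} {i : ι} (m : M i) {w : {w : Word M // w.toList.length ≤ n}}
    (hw : w.1 ∈ shortOrbitWords M n i) : (truncatedPerm M n i m w).1 = of m • w.1 :=
  congrArg Subtype.val (Equiv.Perm.viaEmbedding_apply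
    (MulAction.toPerm m : Equiv.Perm (shortOrbitWords M n i)) _ ⟨w.1, hw⟩)

theorem lift_truncatedPerm_empty {n : ℕ} (w : Word M) (hw : w.toList.length ≤ n) :
    (lift (truncatedPerm M n) w.prod ⟨Word.empty, Nat.zero_le n⟩).1 = w := by
  induction w using Word.consRecOn with
  | empty => rw [Word.prod_empty, map_one, Equiv.Perm.one_apply]
  | cons i m w hi hm ih =>
    have hlt : w.toList.length < n := hw
    have ih := ih hlt.le
    rw [Word.prod_cons, map_mul, lift_of, Equiv.Perm.mul_apply, truncatedPerm_apply, ih,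
      Word.cons_eq_smul]
    rw [ih]
    change (Word.equivPair i w).tail.toList.length < n
    rwa [Word.equivPair_eq_of_fstIdx_ne hi]

end DecidableEq

theorem residuallyFinite_coprodI [Finite ι] [∀ i, Finite (M i)] :
    Group.ResiduallyFinite (CoprodI M) := by
  classical
  refine Group.residuallyFinite_of_forall_exists_finite_monoidHom fun g hg => ?_
  let n := (Word.equiv g).toList.length
  have := finite_word_length_le (M := M) n
  refine ⟨_, inferInstance, inferInstance, lift (truncatedPerm M n), fun h => hg ?_⟩
  have hword := lift_truncatedPerm_empty (Word.equiv g) le_rfl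
  have hprod : (Word.equiv g).prod = g := Word.equiv.symm_apply_apply g
  rw [hprod, h] at hword
  rw [← hprod, ← hword]
  exact Word.prod_empty

theorem IsLEF.coprodI [Finite ι] (hM : ∀ i, IsLEF (M i)) : IsLEF (CoprodI M) := by
  classical
  refine IsLEF.of_exists_isPartialHomOn.{max u v, u} fun A => ?_
  let letters (a : CoprodI M) : List (Σ i, M i) := (Word.equiv a).toList
  have hletters (a : CoprodI M) : ((letters a).map fun l => of l.2).prod = a :=
    Word.equiv.symm_apply_apply a
  obtain ⟨T, h1T, hT⟩ := exists_hasLettersIn ((A ×ˢ A).biUnion fun p =>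
    ((letters p.1).tails.map fun L => (L.map fun l => of l.2).prod • Word.equiv p.2).toFinset)
  have hTsuffix {a b : CoprodI M} (ha : a ∈ A) (hb : b ∈ A) (L) (hL : L <:+ letters a) :
      HasLettersIn T ((L.map fun l => of l.2).prod • Word.equiv b) :=
    hT _ (Finset.mem_biUnion.2 ⟨(a, b), Finset.mk_mem_product ha hb, List.mem_toFinset.2
      (List.mem_map.2 ⟨L, (List.mem_tails _ _).2 hL, rfl⟩)⟩)
  have hTword {a : CoprodI M} (ha : a ∈ A) : HasLettersIn T (Word.equiv a) := by
    simpa using hTsuffix ha ha [] List.nil_suffix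
  choose Q _ _ φ hφ hinj using fun i => hM i (T i)
  have := residuallyFinite_coprodI (M := Q)
  refine ⟨CoprodI Q, inferInstance, fun a => mapLetters φ (Word.equiv a), of_residuallyFinite _,
    fun a ha b hb _ => ?_,
    (mapLetters_injOn h1T (fun i => (hφ i).map_one (h1T i)) hinj).comp
      Word.equiv.injective.injOn fun a ha => hTword ha⟩
  have hab : Word.equiv (a * b) = ((letters a).map fun l => of l.2).prod • Word.equiv b := by
    rw [hletters]
    exact mul_smul a b (Word.empty (M := M))
  simp only [hab]
  exact mapLetters_prod_smul h1T hφ (hTword ha) (hTsuffix ha hb)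

end FreeProduct

/-! ### Supports and retractions in graph products -/

theorem not_commute_coprodI_of {ι : Type u} {M : ι → Type v} [∀ i, Group (M i)] {i j : ι}
    (hij : i ≠ j) {x : M i} {y : M j} (hx : x ≠ 1) (hy : y ≠ 1) :
    ¬ Commute (CoprodI.of x) (CoprodI.of y) := by
  classical
  intro hcomm
  let xy := (CoprodI.NeWord.singleton x hx).append hij (.singleton y hy)
  let yx := (CoprodI.NeWord.singleton y hy).append hij.symm (.singleton x hx)
  have hprod : xy.prod = yx.prod := by
    simpa only [xy, yx, CoprodI.NeWord.append_prod, CoprodI.NeWord.prod_singleton] using hcomm.eq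
  have hword : xy.toWord = yx.toWord := CoprodI.Word.equiv.symm.injective hprod
  have hlist : [⟨i, x⟩, ⟨j, y⟩] = ([⟨j, y⟩, ⟨i, x⟩] : List (Σ i, M i)) :=
    congrArg CoprodI.Word.toList hword
  exact hij (congrArg Sigma.fst (List.cons.inj hlist).1)

namespace GraphProduct

section Family

variable {V : Type*} {H : V → Type*} [∀ v, Group (H v)] {X : SimpleGraph V}

/-- The universal property of graph products. -/
def lift {M : Type*} [Group M] (f : ∀ v, H v →* M)
    (hf : ∀ ⦃v w⦄, X.Adj v w → ∀ h k, Commute (f v h) (f w k)) : GraphProduct H X →* M :=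
  QuotientGroup.lift _ (CoprodI.lift f) (by
    apply Subgroup.normalClosure_le_normal
    rintro _ ⟨v, w, hvw, h, k, rfl⟩
    simp only [SetLike.mem_coe, MonoidHom.mem_ker, map_mul, map_inv, CoprodI.lift_of]
    rw [mul_assoc, (hf hvw h k).eq]
    group)

@[simp]
theorem lift_of {M : Type*} [Group M] (f : ∀ v, H v →* M)
    (hf : ∀ ⦃v w⦄, X.Adj v w → ∀ h k, Commute (f v h) (f w k)) (v : V) (h : H v) :
    lift f hf (of X v h) = f v h :=
  CoprodI.lift_of f h

theorem induction_on {p : GraphProduct H X → Prop} (x : GraphProduct H X) (one : p 1)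
    (of : ∀ v h, p (of X v h)) (mul : ∀ x y, p x → p y → p (x * y)) : p x := by
  obtain ⟨x, rfl⟩ := QuotientGroup.mk_surjective x
  induction x using CoprodI.induction_on with
  | one => exact one
  | of v h => exact of v h
  | mul x y hx hy => exact mul _ _ hx hy

/-- The projection of a graph product to the vertex group at `v`, which kills the others. -/
def proj [DecidableEq V] (X : SimpleGraph V) (v : V) : GraphProduct H X →* H v :=
  lift (fun u => (Pi.evalMonoidHom H v).comp (MonoidHom.mulSingle H u)) fun _ _ huw h k =>
    (Pi.mulSingle_commute huw.ne h k).map (Pi.evalMonoidHom H v)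

@[simp]
theorem proj_of [DecidableEq V] (u v : V) (h : H u) :
    proj X v (of X u h) = Pi.mulSingle u h v :=
  lift_of _ _ u h

theorem of_injective (X : SimpleGraph V) (v : V) : Function.Injective (of (H := H) X v) := by
  classical
  exact Function.LeftInverse.injective (g := proj X v) fun h => by simp

theorem of_ne_of {v w : V} (hvw : v ≠ w) {h : H v} (hh : h ≠ 1) (k : H w) :
    of X v h ≠ of X w k := by
  classical
  intro heq
  have hproj := congrArg (proj X v) heq
  simp only [proj_of, Pi.mulSingle_eq_same, Pi.mulSingle_eq_of_ne hvw] at hproj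
  exact hh hproj

theorem commute_of_iff {v w : V} (hvw : v ≠ w) {h : H v} {k : H w} (hh : h ≠ 1) (hk : k ≠ 1) :
    Commute (of X v h) (of X w k) ↔ X.Adj v w := by
  classical
  refine ⟨fun hcomm => ?_, fun hadj => of_commute hadj h k⟩
  by_contra hadj
  let f : GraphProduct H X →* CoprodI H :=
    lift (fun u => if u = v ∨ u = w then CoprodI.of else 1) fun a b hab x y => by
      by_cases ha : a = v ∨ a = w
      · have hb : ¬ (b = v ∨ b = w) := by
          rintro (rfl | rfl) <;> rcases ha with rfl | rfl
          · exact hab.ne rfl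
          · exact hadj hab.symm
          · exact hadj hab
          · exact hab.ne rfl
        simp only [if_neg hb, MonoidHom.one_apply, Commute.one_right]
      · simp only [if_neg ha, MonoidHom.one_apply, Commute.one_left]
  exact not_commute_coprodI_of hvw hh hk (by simpa [f] using hcomm.map f)

variable (H X) in
/-- The subgroup of the graph product generated by the vertex groups at the vertices in `Z`. -/
def supported (Z : Set V) : Subgroup (GraphProduct H X) :=
  Subgroup.closure {x | ∃ v ∈ Z, ∃ h, of X v h = x}

theorem of_mem_supported {Z : Set V} {v : V} (hv : v ∈ Z) (h : H v) :
    of X v h ∈ supported H X Z :=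
  Subgroup.subset_closure ⟨v, hv, h, rfl⟩

theorem supported_mono {Z Z' : Set V} (hZ : Z ⊆ Z') : supported H X Z ≤ supported H X Z' :=
  Subgroup.closure_mono fun _ ⟨v, hv, h, hx⟩ => ⟨v, hZ hv, h, hx⟩

theorem exists_finset_mem_supported (x : GraphProduct H X) :
    ∃ Z : Finset V, x ∈ supported H X (Z : Set V) := by
  classical
  induction x using induction_on with
  | one => exact ⟨∅, one_mem _⟩
  | of v h => exact ⟨{v}, of_mem_supported (Finset.mem_coe.2 (Finset.mem_singleton_self v)) h⟩
  | mul x y hx hy =>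
    obtain ⟨Z, hZ⟩ := hx
    obtain ⟨Z', hZ'⟩ := hy
    exact ⟨Z ∪ Z', mul_mem (supported_mono (Finset.coe_subset.2 Finset.subset_union_left) hZ)
      (supported_mono (Finset.coe_subset.2 Finset.subset_union_right) hZ')⟩

theorem exists_finset_forall_mem_supported (A : Finset (GraphProduct H X)) :
    ∃ Z : Finset V, ∀ x ∈ A, x ∈ supported H X (Z : Set V) := by
  classical
  choose Z hZ using exists_finset_mem_supported (H := H) (X := X)
  exact ⟨A.biUnion Z, fun x hx =>
    supported_mono (Finset.coe_subset.2 (Finset.subset_biUnion_of_mem Z hx)) (hZ x)⟩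

theorem eqOn_supported {M : Type*} [Group M] {f g : GraphProduct H X →* M} {Z : Set V}
    (hfg : ∀ v ∈ Z, ∀ h, f (of X v h) = g (of X v h)) : Set.EqOn f g (supported H X Z) := by
  refine MonoidHom.eqOn_closure ?_
  rintro _ ⟨v, hv, h, rfl⟩
  exact hfg v hv h

end Family

section Copies

variable {V W : Type*} {X : SimpleGraph V} {Y : SimpleGraph W} {H : Type*} [Group H]

/-- The canonical map of `H` to its copy at the vertex `v` in a graph product of copies of `H`. -/
abbrev copy (H : Type*) [Group H] (X : SimpleGraph V) (v : V) :
    H →* GraphProduct (fun _ : V => H) X :=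
  of (H := fun _ : V => H) X v

/-- The homomorphism of graph products of copies of `H` that is inverse to an embedding `π` of
graphs on the copies of `H` at the vertices in the range of `π`, and kills the other copies. -/
noncomputable def retraction (H : Type*) [Group H] (π : X ↪g Y) :
    GraphProduct (fun _ : W => H) Y →* GraphProduct (fun _ : V => H) X :=
  lift (Function.extend π (copy H X) 1) fun w w' hadj h k => by
    by_cases hw : ∃ v, π v = w
    · by_cases hw' : ∃ v', π v' = w'
      · obtain ⟨v, rfl⟩ := hw
        obtain ⟨v', rfl⟩ := hw'
        simp only [π.injective.extend_apply]
        exact of_commute (H := fun _ : V => H) (π.map_adj_iff.1 hadj) h k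
      · simp only [Function.extend_apply' _ _ _ hw', Pi.one_apply, MonoidHom.one_apply,
          Commute.one_right]
    · simp only [Function.extend_apply' _ _ _ hw, Pi.one_apply, MonoidHom.one_apply,
        Commute.one_left]

@[simp]
theorem retraction_of (π : X ↪g Y) (v : V) (h : H) :
    retraction H π (copy H Y (π v) h) = copy H X v h := by
  rw [retraction, lift_of, π.injective.extend_apply]

/-- The homomorphism of graph products of copies of `H` induced by an embedding `π` of the
subgraph induced on `Z`; it kills the copies of `H` at the vertices outside `Z`. -/
noncomputable def mapInduced (H : Type*) [Group H] {Z : Set V} (π : X.induce Z ↪g Y) :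
    GraphProduct (fun _ : V => H) X →* GraphProduct (fun _ : W => H) Y :=
  (map H π.toHom).comp (retraction H (SimpleGraph.Embedding.induce Z))

theorem mapInduced_of {Z : Set V} (π : X.induce Z ↪g Y) {v : V} (hv : v ∈ Z) (h : H) :
    mapInduced H π (copy H X v h) = copy H Y (π ⟨v, hv⟩) h :=
  (congrArg (map H π.toHom) (retraction_of (SimpleGraph.Embedding.induce Z) ⟨v, hv⟩ h)).trans
    (map_of H π.toHom ⟨v, hv⟩ h)

theorem mapInduced_injOn {Z : Set V} (π : X.induce Z ↪g Y) :
    Set.InjOn (mapInduced H π) (supported (fun _ => H) X Z) := by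
  let ψ := (map H (SimpleGraph.Embedding.induce Z).toHom).comp (retraction H π)
  have hψ : Set.EqOn (ψ.comp (mapInduced H π)) (MonoidHom.id _) (supported (fun _ => H) X Z) :=
    eqOn_supported fun v hv h => by
      rw [MonoidHom.comp_apply, mapInduced_of π hv, MonoidHom.comp_apply, retraction_of, map_of]
      rfl
  exact Set.LeftInvOn.injOn (f₁' := ψ) hψ

end Copies

end GraphProduct

/-! ### Conjugation on commuting graphs -/

/-- The graph on `M` in which two distinct elements are adjacent if they commute. -/
def commutingGraph (M : Type*) [Mul M] : SimpleGraph M where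
  Adj a b := a ≠ b ∧ Commute a b
  symm := ⟨fun _ _ h => ⟨h.1.symm, h.2.symm⟩⟩
  loopless := ⟨fun _ h => h.1 rfl⟩

/-- The embedding of commuting graphs given by an injective homomorphism. -/
def commutingGraphEmbedding {M N : Type*} [Mul M] [Mul N] (f : M →ₙ* N)
    (hf : Function.Injective f) : commutingGraph M ↪g commutingGraph N where
  toFun := f
  inj' := hf
  map_rel_iff' := and_congr hf.ne_iff (commute_map_iff hf)

/-- The embedding of a graph in the commuting graph of a graph product over it that is given by a
choice of nontrivial elements of the vertex groups. -/
def GraphProduct.commutingGraphEmbedding {V : Type*} (H : V → Type*) [∀ v, Group (H v)]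
    (X : SimpleGraph V) (h : ∀ v, H v) (hh : ∀ v, h v ≠ 1) :
    X ↪g commutingGraph (GraphProduct H X) where
  toFun v := of X v (h v)
  inj' v w hvw := by_contra fun hne => of_ne_of hne (hh v) (h w) hvw
  map_rel_iff' {v w} := by
    refine ⟨fun hvw => ?_, fun hvw => ⟨of_ne_of hvw.ne (hh v) (h w), of_commute hvw _ _⟩⟩
    have hne : v ≠ w := fun e => hvw.1 (e ▸ rfl)
    exact (commute_of_iff hne (hh v) (hh w)).1 hvw.2

/-- The action of a group on its commuting graph by conjugation. -/
def commutingGraphConj (G : Type*) [Group G] : G →* (commutingGraph G ≃g commutingGraph G) where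
  toFun g :=
    { toEquiv := (MulAut.conj g).toEquiv
      map_rel_iff' := by
        intro a b
        exact and_congr (MulAut.conj g).injective.ne_iff
          (commute_map_iff (MulAut.conj g).injective) }
  map_one' := RelIso.ext fun x => DFunLike.congr_fun (map_one MulAut.conj) x
  map_mul' g h := RelIso.ext fun x => DFunLike.congr_fun (map_mul MulAut.conj g h) x

theorem IsLEF.isLEFGraphAction_commutingGraphConj {G : Type u} [Group G] (hG : IsLEF G) :
    IsLEFGraphAction (commutingGraphConj G) := by
  classical
  intro F Z
  obtain ⟨Q, _, _, φ, hφ, hinj, hmul⟩ := hG.exists_mul_eq_mul_iff (F ∪ Z)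
  have hF {g} (hg : g ∈ F) : g ∈ F ∪ Z := Finset.mem_union_left Z hg
  have hZ {x} (hx : x ∈ Z) : x ∈ F ∪ Z := Finset.mem_union_right F hx
  let π : (commutingGraph G).induce (Z : Set G) ↪g commutingGraph Q :=
    { toFun := fun x => φ x
      inj' := fun x y hxy => Subtype.ext (hinj (hZ x.2) (hZ y.2) hxy)
      map_rel_iff' := fun {x y} => and_congr (hinj.ne_iff (hZ x.2) (hZ y.2))
        (hmul x (hZ x.2) y (hZ y.2) y (hZ y.2) x (hZ x.2)) }
  refine ⟨Q, inferInstance, inferInstance, Q, inferInstance, commutingGraph Q,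
    commutingGraphConj Q, φ, π, fun g hg h hh hgh => hφ g (hF hg) h (hF hh) (hF hgh),
    fun g hg x hx hgx => eq_mul_inv_of_mul_eq ?_⟩
  exact (hmul _ (hZ hgx) g (hF hg) g (hF hg) x (hZ hx)).2 (inv_mul_cancel_right _ _)

theorem IsLEFGraphAction.of_embedding {Γ Λ V W : Type*} [Group Γ] [Group Λ] {X : SimpleGraph V}
    {Y : SimpleGraph W} {α : Γ →* (X ≃g X)} {β : Λ →* (Y ≃g Y)} (hβ : IsLEFGraphAction β)
    (i : Γ →* Λ) (j : X ↪g Y) (hij : ∀ g x, j (α g x) = β (i g) (j x)) : IsLEFGraphAction α := by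
  classical
  intro F Z
  obtain ⟨Q, _, _, W', _, Y', γ, ρ, π, hρ, hπ⟩ := hβ (F.image i) (Z.map j.toEmbedding)
  have hF {g} (hg : g ∈ F) : i g ∈ F.image i := Finset.mem_image_of_mem i hg
  have hZ {x} (hx : x ∈ Z) : j x ∈ Z.map j.toEmbedding := Finset.mem_map_of_mem j.toEmbedding hx
  let jZ : X.induce (Z : Set V) ↪g Y.induce (Z.map j.toEmbedding : Set W) :=
    { toFun := fun x => ⟨j x, hZ x.2⟩
      inj' := fun x y hxy => Subtype.ext (j.injective (congrArg Subtype.val hxy))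
      map_rel_iff' := j.map_adj_iff }
  refine ⟨Q, inferInstance, inferInstance, W', inferInstance, Y', γ, ρ ∘ i, π.comp jZ,
    hρ.comp (.of_monoidHom F i) fun _ => hF, fun g hg x hx hgx => ?_⟩
  refine Eq.trans (congrArg π (Subtype.ext (hij g x))) (hπ (i g) (hF hg) (j x) (hZ hx) ?_)
  exact hij g x ▸ hZ hgx

theorem GraphWreathProduct.inr_mul_inl_copy_mul_inv {Γ H V : Type*} [Group Γ] [Group H]
    {X : SimpleGraph V} (α : Γ →* (X ≃g X)) (g : Γ) (v : V) (h : H) :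
    (SemidirectProduct.inr g * SemidirectProduct.inl (GraphProduct.copy H X v h) *
      (SemidirectProduct.inr g)⁻¹ : GraphWreathProduct H α) =
      SemidirectProduct.inl (GraphProduct.copy H X (α g v) h) := by
  rw [← map_inv, ← SemidirectProduct.inl_aut, MonoidHom.comp_apply, GraphProduct.autAction_of]

theorem IsLEF.isLEFGraphAction {Γ : Type u} {H : Type v} [Group Γ] [Group H] [Nontrivial H]
    {V : Type w} {X : SimpleGraph V} {α : Γ →* (X ≃g X)}
    (hW : IsLEF (GraphWreathProduct H α)) : IsLEFGraphAction α := by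
  obtain ⟨h, hh⟩ := exists_ne (1 : H)
  let j : X ↪g commutingGraph (GraphWreathProduct H α) :=
    (commutingGraphEmbedding (SemidirectProduct.inl : _ →* _).toMulHom
      SemidirectProduct.inl_injective).comp
        (GraphProduct.commutingGraphEmbedding (fun _ : V => H) X (fun _ => h) fun _ => hh)
  exact hW.isLEFGraphAction_commutingGraphConj.of_embedding SemidirectProduct.inr j
    fun g x => (GraphWreathProduct.inr_mul_inl_copy_mul_inv α g x h).symm

/-! ### Local models of actions -/

section LocalModel

variable {Γ Q V W : Type*} [Group Γ] [Group Q] {X : SimpleGraph V} {Y : SimpleGraph W}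
  {α : Γ →* (X ≃g X)} {β : Q →* (Y ≃g Y)} {F : Finset Γ} {Z : Finset V} {ρ : Γ → Q}
  {π : X.induce (Z : Set V) ↪g Y}

/-- The action `β` models the action `α` on the finite set `F` of group elements and the finite set
`Z` of vertices by means of `ρ` and `π`. The action `α` is LEF if all `F` and `Z` admit models with
finite `Q` and `Y`; here they may be infinite. -/
structure IsLocalModel (α : Γ →* (X ≃g X)) (β : Q →* (Y ≃g Y)) (F : Finset Γ) (Z : Finset V)
    (ρ : Γ → Q) (π : X.induce (Z : Set V) ↪g Y) : Prop where
  isPartialHomOn : IsPartialHomOn F ρ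
  map_apply : ∀ g ∈ F, ∀ (x : V) (hx : x ∈ Z) (hgx : α g x ∈ Z),
    π ⟨α g x, hgx⟩ = β (ρ g) (π ⟨x, hx⟩)

theorem IsLocalModel.prod (h : IsLocalModel α β F Z ρ π) {Q' : Type*} [Group Q'] {φ : Γ → Q'}
    (hφ : IsPartialHomOn F φ) :
    IsLocalModel α (β.comp (MonoidHom.fst Q Q')) F Z (fun g => (ρ g, φ g)) π where
  isPartialHomOn g hg k hk hgk :=
    Prod.ext (h.isPartialHomOn g hg k hk hgk) (hφ g hg k hk hgk)
  map_apply := h.map_apply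

/-- The map of graph wreath products induced by the maps `ρ` of groups and `π` of graphs of a local
model. -/
noncomputable def wreathMap (H : Type*) [Group H] (α : Γ →* (X ≃g X)) (β : Q →* (Y ≃g Y))
    (ρ : Γ → Q) {Z : Set V} (π : X.induce Z ↪g Y) (a : GraphWreathProduct H α) :
    GraphWreathProduct H β :=
  ⟨GraphProduct.mapInduced H π a.left, ρ a.right⟩

variable {H : Type*} [Group H] {A : Finset (GraphWreathProduct H α)}

theorem IsLocalModel.isPartialHomOn_wreathMap (h : IsLocalModel α β F Z ρ π) {Z₀ : Set V}
    (hZ₀ : Z₀ ⊆ Z) (hFZ₀ : ∀ g ∈ F, ∀ v ∈ Z₀, α g v ∈ Z) (hAF : ∀ a ∈ A, a.right ∈ F)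
    (hAZ₀ : ∀ a ∈ A, a.left ∈ GraphProduct.supported (fun _ => H) X Z₀) :
    IsPartialHomOn A (wreathMap H α β ρ π) := by
  intro a ha b hb hab
  refine SemidirectProduct.ext ?_
    (h.isPartialHomOn _ (hAF a ha) _ (hAF b hb) (hAF _ hab))
  have hequiv : Set.EqOn
      ((GraphProduct.mapInduced H π).comp (GraphProduct.autAction H X (α a.right)).toMonoidHom)
      ((GraphProduct.autAction H Y (β (ρ a.right))).toMonoidHom.comp (GraphProduct.mapInduced H π))
      (GraphProduct.supported (fun _ => H) X Z₀) :=
    GraphProduct.eqOn_supported fun v hv k => by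
      have hgv := hFZ₀ _ (hAF a ha) v hv
      simp only [MonoidHom.comp_apply, MulEquiv.coe_toMonoidHom]
      rw [GraphProduct.autAction_of, GraphProduct.mapInduced_of π hgv,
        GraphProduct.mapInduced_of π (hZ₀ hv), GraphProduct.autAction_of,
        h.map_apply _ (hAF a ha) v (hZ₀ hv) hgv]
  simp only [wreathMap, SemidirectProduct.mul_left, map_mul]
  exact congrArg _ (hequiv (hAZ₀ b hb))

theorem wreathMap_injOn (hρ : Set.InjOn ρ F) (hAF : ∀ a ∈ A, a.right ∈ F)
    (hAZ : ∀ a ∈ A, a.left ∈ GraphProduct.supported (fun _ => H) X Z) :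
    Set.InjOn (wreathMap H α β ρ π) A := fun a ha b hb hab =>
  SemidirectProduct.ext
    (GraphProduct.mapInduced_injOn π (hAZ a ha) (hAZ b hb) (congrArg SemidirectProduct.left hab))
    (hρ (hAF a ha) (hAF b hb) (congrArg SemidirectProduct.right hab))

end LocalModel

theorem IsLEF.graphWreathProduct_of_isLocalModel {Γ : Type u} {H : Type v} [Group Γ] [Group H]
    {V : Type w} {X : SimpleGraph V} {α : Γ →* (X ≃g X)} (hΓ : IsLEF Γ)
    (hα : ∀ (F : Finset Γ) (Z : Finset V),
      ∃ (Q : Type) (_ : Group Q) (_ : Finite Q) (W : Type) (Y : SimpleGraph W)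
        (β : Q →* (Y ≃g Y)) (ρ : Γ → Q) (π : X.induce (Z : Set V) ↪g Y),
        IsLocalModel α β F Z ρ π ∧ IsLEF (GraphProduct (fun _ : W => H) Y)) :
    IsLEF (GraphWreathProduct H α) := by
  classical
  refine IsLEF.of_exists_isPartialHomOn fun A => ?_
  obtain ⟨Z₀, hAZ₀⟩ := GraphProduct.exists_finset_forall_mem_supported
    (A.image SemidirectProduct.left)
  let F : Finset Γ := A.image SemidirectProduct.right
  let Z : Finset V := Z₀ ∪ F.biUnion fun g => Z₀.image (α g)
  have hZ₀ : (Z₀ : Set V) ⊆ Z := Finset.coe_subset.2 Finset.subset_union_left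
  have hFZ₀ (g) (hg : g ∈ F) (v) (hv : v ∈ Z₀) : α g v ∈ Z :=
    Finset.mem_union_right _ (Finset.mem_biUnion.2 ⟨g, hg, Finset.mem_image_of_mem _ hv⟩)
  have hAF (a) (ha : a ∈ A) : a.right ∈ F := Finset.mem_image_of_mem _ ha
  replace hAZ₀ (a) (ha : a ∈ A) := hAZ₀ a.left (Finset.mem_image_of_mem _ ha)
  obtain ⟨Q, _, _, W, Y, β, ρ, π, hmodel, hY⟩ := hα F Z
  obtain ⟨Q', _, _, φ, hφ, hφinj⟩ := hΓ F
  exact ⟨GraphWreathProduct H (β.comp (MonoidHom.fst Q Q')), inferInstance,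
    wreathMap H α _ (fun g => (ρ g, φ g)) π, hY.semidirectProduct _,
    (hmodel.prod hφ).isPartialHomOn_wreathMap hZ₀ hFZ₀ hAF hAZ₀,
    wreathMap_injOn (fun g hg k hk hgk => hφinj hg hk (congrArg Prod.snd hgk)) hAF
      fun a ha => GraphProduct.supported_mono hZ₀ (hAZ₀ a ha)⟩

theorem IsLEF.graphProduct_bot {W : Type u} [Finite W] {H : W → Type v} [∀ w, Group (H w)]
    (hH : ∀ w, IsLEF (H w)) : IsLEF (GraphProduct H ⊥) := by
  let f : GraphProduct H ⊥ →* CoprodI H :=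
    GraphProduct.lift (fun _ => CoprodI.of) fun _ _ h => h.elim
  let g : CoprodI H →* GraphProduct H ⊥ := QuotientGroup.mk' _
  have hgf : g.comp f = MonoidHom.id _ := GraphProduct.hom_ext fun w h =>
    congrArg g (GraphProduct.lift_of _ _ w h)
  exact (IsLEF.coprodI hH).of_injective f
    (Function.LeftInverse.injective (g := g) (DFunLike.congr_fun hgf))

/-- For homomorphisms `k` and `r` from `G` to `K`, the action of `G` on the edgeless graph with
vertex set `K` where `g` acts by `x ↦ k g * x * (r g)⁻¹`. -/
def twoSidedMul {G K : Type*} [Group G] [Group K] (k r : G →* K) :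
    G →* ((⊥ : SimpleGraph K) ≃g (⊥ : SimpleGraph K)) where
  toFun g := ⟨(Equiv.mulLeft (k g)).trans (Equiv.mulRight (r g)⁻¹), Iff.rfl⟩
  map_one' := by ext x; simp
  map_mul' g h := by ext x; simp [mul_assoc]

@[simp]
theorem twoSidedMul_apply {G K : Type*} [Group G] [Group K] (k r : G →* K) (g : G) (x : K) :
    twoSidedMul k r g x = k g * x * (r g)⁻¹ :=
  rfl

theorem IsLEF.graphWreathProduct_twoSidedMul {G : Type u} {K : Type w} {H : Type v} [Group G]
    [Group K] [Group H] (hG : IsLEF G) (hK : IsLEF K) (hH : IsLEF H) (k r : G →* K) :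
    IsLEF (GraphWreathProduct H (twoSidedMul k r)) := by
  classical
  refine hG.graphWreathProduct_of_isLocalModel fun F Z => ?_
  obtain ⟨Q, _, _, φ, hφ, hinj, hmul⟩ := hK.exists_mul_eq_mul_iff (F.image k ∪ F.image r ∪ Z)
  have hkF {g} (hg : g ∈ F) : k g ∈ F.image k ∪ F.image r ∪ Z :=
    Finset.mem_union_left _ (Finset.mem_union_left _ (Finset.mem_image_of_mem k hg))
  have hrF {g} (hg : g ∈ F) : r g ∈ F.image k ∪ F.image r ∪ Z :=
    Finset.mem_union_left _ (Finset.mem_union_right _ (Finset.mem_image_of_mem r hg))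
  have hZ {x} (hx : x ∈ Z) : x ∈ F.image k ∪ F.image r ∪ Z := Finset.mem_union_right _ hx
  let π : (⊥ : SimpleGraph K).induce (Z : Set K) ↪g (⊥ : SimpleGraph Q) :=
    { toFun := fun x => φ x
      inj' := fun x y hxy => Subtype.ext (hinj (hZ x.2) (hZ y.2) hxy)
      map_rel_iff' := Iff.rfl }
  refine ⟨Q × Q, inferInstance, inferInstance, Q, ⊥,
    twoSidedMul (MonoidHom.fst Q Q) (MonoidHom.snd Q Q), fun g => (φ (k g), φ (r g)), π, ⟨?_, ?_⟩,
    IsLEF.graphProduct_bot fun _ => hH⟩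
  · exact fun g hg h hh hgh =>
      Prod.ext (hφ.comp (.of_monoidHom F k) (fun _ => hkF) g hg h hh hgh)
        (hφ.comp (.of_monoidHom F r) (fun _ => hrF) g hg h hh hgh)
  · exact fun g hg x hx hgx => eq_mul_inv_of_mul_eq
      ((hmul _ (hZ hgx) _ (hrF hg) _ (hkF hg) _ (hZ hx)).2 (inv_mul_cancel_right _ _))

/-! ### Graph products over finite graphs -/

namespace GraphProduct

/-- The homomorphism to a graph product from the graph product of the vertex groups at the values of
`e` over the pulled-back graph. -/
def ofComap {V W : Type*} {H : V → Type*} [∀ v, Group (H v)] (Y : SimpleGraph V) (e : W → V) :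
    GraphProduct (fun w => H (e w)) (Y.comap e) →* GraphProduct H Y :=
  lift (fun w => of Y (e w)) fun _ _ hadj h k => of_commute (X := Y) hadj h k

@[simp]
theorem ofComap_of {V W : Type*} {H : V → Type*} [∀ v, Group (H v)] (Y : SimpleGraph V) (e : W → V)
    (w : W) (h : H (e w)) :
    ofComap Y e (of (H := fun w => H (e w)) (Y.comap e) w h) = of Y (e w) h :=
  lift_of (H := fun w => H (e w)) _ _ w h

variable {V : Type*} {H : Option V → Type*} [∀ v, Group (H v)] (Y : SimpleGraph (Option V))

variable (H) in
/-- The graph product over the complement of the vertex `none`. -/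
abbrev RemoveNone : Type _ :=
  GraphProduct (fun v => H (some v)) (Y.comap some)

/-- The canonical map of a vertex group to the graph product over the complement of `none`. -/
abbrev ofSome (v : V) : H (some v) →* RemoveNone H Y :=
  of (H := fun v => H (some v)) (Y.comap some) v

open scoped Classical in
/-- The retraction of the graph product over the complement of the vertex `none` to the part
supported on the neighbours of `none`. -/
noncomputable def linkRetraction : RemoveNone H Y →* RemoveNone H Y :=
  lift (fun v => if Y.Adj none (some v) then ofSome Y v else 1)
    fun v w hadj h k => by
      split_ifs
      · exact of_commute (H := fun v => H (some v)) hadj h k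
      all_goals simp only [MonoidHom.one_apply, Commute.one_left, Commute.one_right]

theorem linkRetraction_of_adj {v : V} (hv : Y.Adj none (some v)) (h : H (some v)) :
    linkRetraction Y (ofSome Y v h) = ofSome Y v h := by
  rw [linkRetraction, lift_of, if_pos hv]

theorem linkRetraction_of_not_adj {v : V} (hv : ¬ Y.Adj none (some v)) (h : H (some v)) :
    linkRetraction Y (ofSome Y v h) = 1 := by
  rw [linkRetraction, lift_of, if_neg hv, MonoidHom.one_apply]

theorem commute_of_none_linkRetraction (h : H none) (g : RemoveNone H Y) :
    Commute (of Y none h) (ofComap Y some (linkRetraction Y g)) := by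
  induction g using induction_on with
  | one => simp only [map_one, Commute.one_right]
  | of v k =>
    by_cases hv : Y.Adj none (some v)
    · rw [linkRetraction_of_adj Y hv, ofComap_of]
      exact of_commute hv h k
    · rw [linkRetraction_of_not_adj Y hv, map_one]
      exact Commute.one_right _
  | mul x y hx hy => simpa only [map_mul] using hx.mul_right hy

variable (H) in
/-- The wreath product of `H none` with the graph product over the complement of `none` that
contains the whole graph product. The cosets of the part supported on the neighbours of `none` would
be the natural vertices; instead, `g` acts on the vertices `x` by `g * x * (r g)⁻¹` for the
retraction `r` to that part, so that local models can be built by multiplication in finite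
groups. -/
abbrev VertexWreath : Type _ :=
  GraphWreathProduct (H none) (twoSidedMul (MonoidHom.id (RemoveNone H Y)) (linkRetraction Y))

theorem commute_inl_inr_vertexWreath {v : V} (hv : Y.Adj none (some v)) (h : H none)
    (k : H (some v)) :
    Commute (SemidirectProduct.inl (copy (H none) ⊥ 1 h) : VertexWreath H Y)
      (SemidirectProduct.inr (ofSome Y v k)) := by
  have hconj := GraphWreathProduct.inr_mul_inl_copy_mul_inv (H := H none)
    (twoSidedMul (MonoidHom.id _) (linkRetraction Y)) (ofSome Y v k) 1 h
  rw [twoSidedMul_apply, linkRetraction_of_adj Y hv, MonoidHom.id_apply, mul_one,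
    mul_inv_cancel] at hconj
  exact (mul_inv_eq_iff_eq_mul.1 hconj).symm

/-- The embedding of a graph product in the wreath product obtained by splitting off the vertex
`none`. -/
noncomputable def toVertexWreath : GraphProduct H Y →* VertexWreath H Y :=
  lift (fun v => match v with
    | none => SemidirectProduct.inl.comp (copy (H none) ⊥ 1)
    | some v => SemidirectProduct.inr.comp (ofSome Y v))
    fun v w hadj h k => by
      match v, w with
      | none, none => exact (hadj.ne rfl).elim
      | none, some w => exact commute_inl_inr_vertexWreath Y hadj h k
      | some v, none => exact (commute_inl_inr_vertexWreath Y hadj.symm k h).symm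
      | some v, some w =>
        exact Commute.map (of_commute (H := fun v => H (some v)) (X := Y.comap some) hadj h k :)
          SemidirectProduct.inr

/-- The homomorphism that sends the copy of `H none` at the vertex `x` to the conjugate of `H none`
by `x`. -/
noncomputable def conjVertexGroup :
    GraphProduct (fun _ : RemoveNone H Y => H none) ⊥ →* GraphProduct H Y :=
  lift (fun x => (MulAut.conj (ofComap Y some x)).toMonoidHom.comp (of Y none))
    fun _ _ hadj => hadj.elim

theorem conjVertexGroup_of (x : RemoveNone H Y) (h : H none) :
    conjVertexGroup Y (copy (H none) ⊥ x h) =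
      ofComap Y some x * of Y none h * (ofComap Y some x)⁻¹ :=
  lift_of (H := fun _ => H none) _ _ x h

theorem conjVertexGroup_twoSidedMul (g x : RemoveNone H Y) (h : H none) :
    conjVertexGroup Y (copy (H none) ⊥ (g * x * (linkRetraction Y g)⁻¹) h) =
      ofComap Y some g * conjVertexGroup Y (copy (H none) ⊥ x h) * (ofComap Y some g)⁻¹ := by
  have hcomm : (ofComap Y some (linkRetraction Y g))⁻¹ * of Y none h *
      ofComap Y some (linkRetraction Y g) = of Y none h := by
    rw [mul_assoc, (commute_of_none_linkRetraction Y h g).eq, inv_mul_cancel_left]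
  simp only [conjVertexGroup_of, map_mul, map_inv, mul_inv_rev, inv_inv]
  conv_rhs => rw [← hcomm]
  group

/-- The left inverse of `toVertexWreath`. -/
noncomputable def ofVertexWreath : VertexWreath H Y →* GraphProduct H Y :=
  SemidirectProduct.lift (conjVertexGroup Y) (ofComap Y some) fun g => hom_ext fun x h => by
    simp only [MonoidHom.comp_apply, MulEquiv.coe_toMonoidHom, autAction_of, twoSidedMul_apply,
      MonoidHom.id_apply, MulAut.conj_apply]
    exact conjVertexGroup_twoSidedMul Y g x h

theorem toVertexWreath_injective : Function.Injective (toVertexWreath (H := H) Y) := by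
  have hid : (ofVertexWreath Y).comp (toVertexWreath Y) = MonoidHom.id (GraphProduct H Y) :=
    hom_ext fun v h => by
      rw [MonoidHom.comp_apply, toVertexWreath, lift_of, MonoidHom.id_apply]
      match v with
      | none =>
        rw [MonoidHom.comp_apply, ofVertexWreath, SemidirectProduct.lift_inl, conjVertexGroup_of,
          map_one, one_mul, inv_one, mul_one]
      | some v => rw [MonoidHom.comp_apply, ofVertexWreath, SemidirectProduct.lift_inr, ofComap_of]
  exact Function.LeftInverse.injective (g := ofVertexWreath Y) (DFunLike.congr_fun hid)

theorem exists_injective_comap_equiv {V W : Type*} {H : V → Type*} [∀ v, Group (H v)]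
    (Y : SimpleGraph V) (e : W ≃ V) :
    ∃ f : GraphProduct H Y →* GraphProduct (fun w => H (e w)) (Y.comap e),
      Function.Injective f := by
  let of' : ∀ v, H v →* GraphProduct (fun w => H (e w)) (Y.comap e) :=
    Equiv.piCongrLeft _ e fun w => of (H := fun w => H (e w)) _ w
  have hof' (w : W) : of' (e w) = of (H := fun w => H (e w)) _ w :=
    Equiv.piCongrLeft_apply_apply _ e _ w
  have hcomm ⦃v v' : V⦄ (hadj : Y.Adj v v') (h : H v) (k : H v') :
      Commute (of' v h) (of' v' k) := by
    obtain ⟨w, rfl⟩ := e.surjective v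
    obtain ⟨w', rfl⟩ := e.surjective v'
    rw [hof', hof']
    exact of_commute (H := fun w => H (e w)) (X := Y.comap e) hadj h k
  have hid : (ofComap Y e).comp (lift of' hcomm) = MonoidHom.id _ := hom_ext fun v h => by
    obtain ⟨w, rfl⟩ := e.surjective v
    rw [MonoidHom.comp_apply, lift_of, hof', ofComap_of, MonoidHom.id_apply]
  exact ⟨lift of' hcomm, Function.LeftInverse.injective (DFunLike.congr_fun hid)⟩

end GraphProduct

theorem IsLEF.graphProduct {W : Type u} [Finite W] {H : W → Type v} [∀ w, Group (H w)]
    (hH : ∀ w, IsLEF (H w)) (Y : SimpleGraph W) : IsLEF (GraphProduct H Y) := by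
  induction W using Finite.induction_empty_option with
  | of_equiv e ih =>
    obtain ⟨f, hf⟩ := GraphProduct.exists_injective_comap_equiv (H := H) Y e
    exact (ih (fun w => hH (e w)) (Y.comap e)).of_injective f hf
  | h_empty =>
    rw [Subsingleton.elim Y ⊥]
    exact IsLEF.graphProduct_bot hH
  | h_option ih =>
    have hG := ih (fun v => hH (some v)) (Y.comap some)
    exact (hG.graphWreathProduct_twoSidedMul hG (hH none) _ _).of_injective _
      (GraphProduct.toVertexWreath_injective Y)

theorem IsLEF.graphWreathProduct {Γ : Type u} {H : Type v} [Group Γ] [Group H] {V : Type w}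
    {X : SimpleGraph V} {α : Γ →* (X ≃g X)} (hΓ : IsLEF Γ) (hH : IsLEF H)
    (hα : IsLEFGraphAction α) : IsLEF (GraphWreathProduct H α) := by
  refine hΓ.graphWreathProduct_of_isLocalModel fun F Z => ?_
  obtain ⟨Q, _, _, W, _, Y, β, ρ, π, hρ, hπ⟩ := hα F Z
  exact ⟨Q, inferInstance, inferInstance, W, Y, β, ρ, π, ⟨hρ, hπ⟩,
    IsLEF.graphProduct (fun _ => hH) Y⟩

theorem mainTheorem9 (Γ : Type u) (H : Type v) [Group Γ] [Group H] [Nontrivial H]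
    {V : Type w} [Nonempty V] (X : SimpleGraph V) (α : Γ →* (X ≃g X)) :
    IsLEF (GraphWreathProduct H α) ↔ IsLEF Γ ∧ IsLEF H ∧ IsLEFGraphAction α := by
  refine ⟨fun hW => ⟨?_, ?_, hW.isLEFGraphAction⟩,
    fun ⟨hΓ, hH, hα⟩ => hΓ.graphWreathProduct hH hα⟩
  · exact hW.of_injective SemidirectProduct.inr SemidirectProduct.inr_injective
  · obtain ⟨v⟩ := ‹Nonempty V›
    exact hW.of_injective (SemidirectProduct.inl.comp (GraphProduct.copy H X v))
      (SemidirectProduct.inl_injective.comp (GraphProduct.of_injective X v))
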